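/- Let $\alpha,\beta$ be indeterminates, let $n\ge 1$, and let $s_i=(i\;\,i+1)$, $1\le i\le n-1$, act on $\mathbb{Z}[\beta,\alpha][x_1,\dots,x_n]$ by interchanging $x_i$ and $x_{i+1}$. Put $$\partial_i(f)=\frac{s_i f-f}{x_{i+1}-x_i},\qquad T_i=-\beta+\bigl((\alpha+\beta)x_i+1+\alpha\beta\,x_ix_{i+1}\bigr)\partial_i .$$ For $w\in S_n$ the Hecke--Grothendieck polynomial is $$\mathcal{KN}_w^{(\beta,\alpha,0)}(x;0)=T_{i_1}T_{i_2}\cdots T_{i_\ell}\bigl(x_1^{n-1}x_2^{n-2}\cdots x_{n-1}\bigr),$$ where $w=s_{i_1}s_{i_2}\cdots s_{i_\ell}$ is any reduced word. **Theorem 1.3.** For every $n\ge 1$ and every $w\in S_n$, the polynomial $\mathcal{KN}_w^{(\beta,\alpha,0)}(x;0)$ is well defined, i.e. it does not depend on the choice of the reduced word of $w$, and it has nonnegative coefficients: $$\mathcal{KN}_w^{(\beta,\alpha,0)}(x;0)\in\mathbb{N}[\beta,\alpha][x_1,\dots,x_n].$$ -/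

import Mathlib

namespace Kirillov

open MvPolynomial

/-! Conventions: the variables `x_1, …, x_n` are `X 0, …, X (n - 1)`, permutations in `S_n` are
`Equiv.Perm (Fin n)`, and the index `i ∈ {1, …, n - 1}` of a simple transposition is an element of
`Fin (n - 1)` (shifted by one). -/

/-- The position `i` (0-based), where `i` is the index of a simple transposition. -/
def lo {n : ℕ} (i : Fin (n - 1)) : Fin n := ⟨i.1, by have := i.2; omega⟩

/-- The position `i + 1` (0-based), where `i` is the index of a simple transposition. -/
def hi {n : ℕ} (i : Fin (n - 1)) : Fin n := ⟨i.1 + 1, by have := i.2; omega⟩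

theorem lo_ne_hi {n : ℕ} (i : Fin (n - 1)) : lo i ≠ hi i := by
  simp [lo, hi, Fin.ext_iff]

/-- The simple transposition `s_i = (i, i+1)` in `S_n`. -/
def simple {n : ℕ} (i : Fin (n - 1)) : Equiv.Perm (Fin n) := Equiv.swap (lo i) (hi i)

/-- `l = (i_1, …, i_ℓ)` is a reduced word of `w`: `w = s_{i_1} ⋯ s_{i_ℓ}` with `ℓ` minimal. -/
def IsReducedWord {n : ℕ} (w : Equiv.Perm (Fin n)) (l : List (Fin (n - 1))) : Prop :=
  (l.map simple).prod = w ∧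
    ∀ l' : List (Fin (n - 1)), (l'.map simple).prod = w → l.length ≤ l'.length

theorem exists_word {n : ℕ} (w : Equiv.Perm (Fin n)) :
    ∃ l : List (Fin (n - 1)), (l.map simple).prod = w := by
  cases n with
  | zero => exact ⟨[], Subsingleton.elim _ _⟩
  | succ m =>
    have hw : w ∈ Submonoid.closure
        (Set.range fun i : Fin m => Equiv.swap i.castSucc i.succ) := by
      rw [Equiv.Perm.mclosure_swap_castSucc_succ]; trivial
    induction hw using Submonoid.closure_induction with
    | mem x hx =>
      obtain ⟨i, rfl⟩ := hx
      refine ⟨[i], ?_⟩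
      simp only [List.map_cons, List.map_nil, List.prod_cons, List.prod_nil, mul_one]
      rfl
    | one => exact ⟨[], rfl⟩
    | mul x y _ _ hx hy =>
      obtain ⟨l, rfl⟩ := hx
      obtain ⟨l', rfl⟩ := hy
      exact ⟨l ++ l', by simp⟩

/-- Every permutation has a reduced word. -/
theorem exists_isReducedWord {n : ℕ} (w : Equiv.Perm (Fin n)) :
    ∃ l : List (Fin (n - 1)), IsReducedWord w l := by
  classical
  have h : ∃ k : ℕ, ∃ l : List (Fin (n - 1)), (l.map simple).prod = w ∧ l.length = k := by
    obtain ⟨l, hl⟩ := exists_word w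
    exact ⟨l.length, l, hl, rfl⟩
  obtain ⟨l, hl, hk⟩ := Nat.find_spec h
  exact ⟨l, hl, fun l' hl' => hk ▸ Nat.find_min' h ⟨l', hl', rfl⟩⟩

section Operators

variable {n : ℕ} {R : Type*} [CommRing R]

/-- `s_i f`: the polynomial `f` with `x_i` and `x_{i+1}` interchanged. -/
noncomputable def swapVars (i : Fin (n - 1)) (f : MvPolynomial (Fin n) R) :
    MvPolynomial (Fin n) R :=
  rename (simple i) f

theorem dvd_swapVars_sub (i : Fin (n - 1)) (f : MvPolynomial (Fin n) R) :
    (X (hi i) - X (lo i) : MvPolynomial (Fin n) R) ∣ swapVars i f - f := by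
  unfold swapVars
  induction f using MvPolynomial.induction_on with
  | C a => simp
  | add p q hp hq =>
    have : rename (simple i) (p + q) - (p + q)
        = (rename (simple i) p - p) + (rename (simple i) q - q) := by
      rw [map_add]; ring
    rw [this]
    exact dvd_add hp hq
  | mul_X p j hp =>
    have hX : (X (hi i) - X (lo i) : MvPolynomial (Fin n) R) ∣ X (simple i j) - X j := by
      unfold simple
      rcases eq_or_ne j (lo i) with rfl | h1
      · rw [Equiv.swap_apply_left]
      · rcases eq_or_ne j (hi i) with rfl | h2
        · rw [Equiv.swap_apply_right]
          exact ⟨-1, by ring⟩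
        · rw [Equiv.swap_apply_of_ne_of_ne h1 h2, sub_self]
          exact dvd_zero _
    have : rename (simple i) (p * X j) - p * X j
        = (rename (simple i) p - p) * X (simple i j) + p * (X (simple i j) - X j) := by
      rw [map_mul, rename_X]; ring
    rw [this]
    exact dvd_add (hp.mul_right _) (hX.mul_left _)

/-- The divided difference `∂_i f = (s_i f - f) / (x_{i+1} - x_i)`, an exact quotient of
polynomials. -/
noncomputable def dividedDiff (i : Fin (n - 1)) (f : MvPolynomial (Fin n) R) :
    MvPolynomial (Fin n) R :=
  (dvd_swapVars_sub i f).choose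

theorem mul_dividedDiff (i : Fin (n - 1)) (f : MvPolynomial (Fin n) R) :
    (X (hi i) - X (lo i)) * dividedDiff i f = swapVars i f - f :=
  (dvd_swapVars_sub i f).choose_spec.symm

/-- Over an integral domain `∂_i f` is the only polynomial with the defining property. -/
theorem eq_dividedDiff [IsDomain R] (i : Fin (n - 1)) (f g : MvPolynomial (Fin n) R)
    (h : (X (hi i) - X (lo i)) * g = swapVars i f - f) : g = dividedDiff i f := by
  have h0 : (X (hi i) - X (lo i) : MvPolynomial (Fin n) R) ≠ 0 :=
    sub_ne_zero.mpr fun e => lo_ne_hi i (X_injective e).symm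
  exact mul_left_cancel₀ h0 (h.trans (mul_dividedDiff i f).symm)

/-- The operator
`T_i f = -β f + ((α + β + γ) x_i + γ x_{i+1} + 1 + (β + γ)(α + γ) x_i x_{i+1}) ∂_i f`. -/
noncomputable def T (β α γ : R) (i : Fin (n - 1)) (f : MvPolynomial (Fin n) R) :
    MvPolynomial (Fin n) R :=
  -C β * f +
    (C (α + β + γ) * X (lo i) + C γ * X (hi i) + 1
      + C ((β + γ) * (α + γ)) * X (lo i) * X (hi i)) * dividedDiff i f

/-- `T_{i_1} (T_{i_2} (⋯ (T_{i_ℓ} f)))` for the word `(i_1, …, i_ℓ)`. -/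
noncomputable def wordT (β α γ : R) (l : List (Fin (n - 1))) (f : MvPolynomial (Fin n) R) :
    MvPolynomial (Fin n) R :=
  l.foldr (T β α γ) f

/-- The monomial `x_1^{d_1} ⋯ x_n^{d_n}` with `d_i = λ_1 - λ_{n+1-i} + n - i`, for a partition
`λ_1 ≥ ⋯ ≥ λ_n ≥ 0`. In 0-based indices `d_i = λ_0 - λ_{n-1-i} + (n - 1 - i)`; no subtraction
truncates when `part` is weakly decreasing. -/
noncomputable def seed (R : Type*) [CommRing R] {n : ℕ} (part : Fin n → ℕ) :
    MvPolynomial (Fin n) R :=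
  ∏ i : Fin n, X i ^ (part ⟨0, i.pos⟩ - part i.rev + (n - 1 - i.1))

/-- The twisted Kirillov polynomial `KN_w^{(β,α,γ)}(x; λ) = T_{i_1} ⋯ T_{i_ℓ} (x^d)`, computed from
some reduced word `(i_1, …, i_ℓ)` of `w`. -/
noncomputable def twistedKirillov (β α γ : R) (w : Equiv.Perm (Fin n)) (part : Fin n → ℕ) :
    MvPolynomial (Fin n) R :=
  wordT β α γ (exists_isReducedWord w).choose (seed R part)

end Operators

/-- The coefficient ring `ℤ[β, α]`. -/
abbrev Coeff : Type := MvPolynomial (Fin 2) ℤ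

/-- The indeterminate `β`. -/
noncomputable def beta : Coeff := X 0

/-- The indeterminate `α`. -/
noncomputable def alpha : Coeff := X 1

/-- The Hecke–Grothendieck polynomial `KN_w^{(β,α,0)}(x; 0)` in `ℤ[β, α][x_1, …, x_n]`. -/
noncomputable def heckeGrothendieck {n : ℕ} (w : Equiv.Perm (Fin n)) :
    MvPolynomial (Fin n) Coeff :=
  twistedKirillov beta alpha 0 w 0

/-- The subset `ℕ[β, α][x_1, …, x_n]` of `ℤ[β, α][x_1, …, x_n]`, the image of the natural map. -/
noncomputable def natPolynomials (n : ℕ) : Set (MvPolynomial (Fin n) Coeff) :=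
  Set.range (MvPolynomial.map (MvPolynomial.map (Nat.castRingHom ℤ)) :
    MvPolynomial (Fin n) (MvPolynomial (Fin 2) ℕ) → MvPolynomial (Fin n) Coeff)

end Kirillov

/-! The polynomials are values of the partition function of a solvable lattice model. A Hecke
algebra acts on functions of words, and its Baxterization `rMatrix` solves the Yang–Baxter equation.
The operator `grid`, applied to the indicator of n-1, …, 0, n, n, …, gives a function Z of boundary
words.

An R-matrix in rows i, i+1 can be pulled through the grid (`rMatrix_mul_grid`). It comes out on two
equal letters n, where it is a scalar, namely the polynomial multiplying ∂_i in T_i. Solving for the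
generator, `heckeGen_partitionFunction` shows that it acts on Z as T_i acts on values. At an ascent
the generator merely exchanges two letters, so Z(w s_i) = T_i Z(w). At the identity the model is
frozen: Z is x_1^{n-1}⋯x_{n-1} times the symmetric factor ∏(1 + βx_j), which commutes with all T_i.
Hence Z(w⁻¹) is this factor times the word operator applied to the seed, for every reduced word of
w. As Z knows nothing of words, cancelling the factor gives independence.

The weights with parameters (0, y) are nonnegative. In each row the horizontal letter changes from n
to a smaller one, which costs a weight 1 + βy; `grid_mul_mem` extracts these factors without leaving
the semiring, so the quotient is nonnegative too. -/

namespace Kirillov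

/-! ### The Hecke algebra acting on functions of words -/

section Hecke

variable {A : Type*} [CommRing A]

/-- The action of a Hecke generator with eigenvalues `α` and `-β` on a function of words, where
`u`, `v` are two adjacent letters and `s`, `t` the values before and after their exchange. -/
def exchangeRule (α β : A) (u v : ℕ) (s t : A) : A :=
  if u < v then t else if u = v then -β * s else (α - β) * s + α * β * t

/-- The word `w` with the letters in the positions `p` and `p + 1` interchanged. -/
def swapLetters (p : ℕ) (w : ℕ → ℕ) : ℕ → ℕ := w ∘ Equiv.swap p (p + 1)

theorem swapLetters_left (p : ℕ) (w : ℕ → ℕ) : swapLetters p w p = w (p + 1) := by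
  simp [swapLetters]

theorem swapLetters_right (p : ℕ) (w : ℕ → ℕ) : swapLetters p w (p + 1) = w p := by
  simp [swapLetters]

theorem swapLetters_of_ne {p j : ℕ} (w : ℕ → ℕ) (h : j ≠ p) (h' : j ≠ p + 1) :
    swapLetters p w j = w j := by
  simp [swapLetters, Equiv.swap_apply_of_ne_of_ne h h']

theorem swapLetters_swapLetters (p : ℕ) (w : ℕ → ℕ) : swapLetters p (swapLetters p w) = w := by
  funext j; simp [swapLetters]

theorem swapLetters_eq_self {p : ℕ} {w : ℕ → ℕ} (h : w p = w (p + 1)) : swapLetters p w = w := by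
  funext j
  rcases eq_or_ne j p with rfl | h1
  · rw [swapLetters_left, h]
  · rcases eq_or_ne j (p + 1) with rfl | h2
    · rw [swapLetters_right, h]
    · exact swapLetters_of_ne w h1 h2

theorem swapLetters_comm {p q : ℕ} (h : p + 2 ≤ q) (w : ℕ → ℕ) :
    swapLetters p (swapLetters q w) = swapLetters q (swapLetters p w) := by
  funext j
  by_cases hp : j = p ∨ j = p + 1
  · rcases hp with rfl | rfl
    · rw [swapLetters_left, swapLetters_of_ne _ (by omega) (by omega),
        swapLetters_of_ne _ (by omega) (by omega), swapLetters_left]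
    · rw [swapLetters_right, swapLetters_of_ne _ (by omega) (by omega),
        swapLetters_of_ne _ (by omega) (by omega), swapLetters_right]
  · push Not at hp
    rw [swapLetters_of_ne _ hp.1 hp.2]
    by_cases hq : j = q ∨ j = q + 1
    · rcases hq with rfl | rfl
      · rw [swapLetters_left, swapLetters_left, swapLetters_of_ne _ (by omega) (by omega)]
      · rw [swapLetters_right, swapLetters_right, swapLetters_of_ne _ (by omega) (by omega)]
    · push Not at hq
      rw [swapLetters_of_ne _ hq.1 hq.2, swapLetters_of_ne _ hq.1 hq.2,
        swapLetters_of_ne _ hp.1 hp.2]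

/-- The Hecke generator acting on the positions `p` and `p + 1` of words. -/
def heckeGen (α β : A) (p : ℕ) : Module.End A ((ℕ → ℕ) → A) where
  toFun f w := exchangeRule α β (w p) (w (p + 1)) (f w) (f (swapLetters p w))
  map_add' f g := by
    funext w; simp only [exchangeRule, Pi.add_apply]; split_ifs <;> ring
  map_smul' c f := by
    funext w
    simp only [exchangeRule, Pi.smul_apply, smul_eq_mul, RingHom.id_apply]; split_ifs <;> ring

variable (α β : A)

theorem heckeGen_apply (p : ℕ) (f : (ℕ → ℕ) → A) (w : ℕ → ℕ) :
    heckeGen α β p f w = exchangeRule α β (w p) (w (p + 1)) (f w) (f (swapLetters p w)) := rfl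

/-- The quadratic relation (h - α)(h + β) = 0. -/
theorem heckeGen_mul_self (p : ℕ) :
    heckeGen α β p * heckeGen α β p = (α - β) • heckeGen α β p + (α * β) • 1 := by
  ext f w
  simp only [Module.End.mul_apply, LinearMap.add_apply, LinearMap.smul_apply, Module.End.one_apply,
    Pi.add_apply, Pi.smul_apply, smul_eq_mul, heckeGen_apply, swapLetters_left, swapLetters_right,
    swapLetters_swapLetters, exchangeRule]
  rcases lt_trichotomy (w p) (w (p + 1)) with h | h | h
  · simp [h, h.not_gt, h.ne']
  · simp only [h, lt_self_iff_false, if_true, if_false]; ring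
  · simp only [h, h.not_gt, h.ne', if_true, if_false]

theorem heckeGen_comm {p q : ℕ} (h : p + 2 ≤ q) :
    Commute (heckeGen α β p) (heckeGen α β q) := by
  ext f w
  simp only [Module.End.mul_apply, heckeGen_apply, swapLetters_comm h]
  rw [swapLetters_of_ne (p := p) (j := q) _ (by omega) (by omega),
    swapLetters_of_ne (p := p) (j := q + 1) _ (by omega) (by omega),
    swapLetters_of_ne (p := q) (j := p) _ (by omega) (by omega),
    swapLetters_of_ne (p := q) (j := p + 1) _ (by omega) (by omega)]
  simp only [exchangeRule]
  split_ifs <;> ring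

/-- The word `w` with its letters in the positions `p`, `p + 1`, `p + 2` replaced. -/
def setThree (w : ℕ → ℕ) (p a b c : ℕ) : ℕ → ℕ := fun j =>
  if j = p then a else if j = p + 1 then b else if j = p + 2 then c else w j

theorem setThree_self (w : ℕ → ℕ) (p : ℕ) :
    setThree w p (w p) (w (p + 1)) (w (p + 2)) = w := by
  funext j; simp only [setThree]; split_ifs <;> simp_all

theorem swapLetters_setThree (w : ℕ → ℕ) (p a b c : ℕ) :
    swapLetters p (setThree w p a b c) = setThree w p b a c := by
  funext j
  rcases eq_or_ne j p with rfl | h1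
  · simp [swapLetters_left, setThree]
  · rcases eq_or_ne j (p + 1) with rfl | h2
    · simp [swapLetters_right, setThree]
    · simp [swapLetters_of_ne _ h1 h2, setThree, h1, h2]

theorem swapLetters_succ_setThree (w : ℕ → ℕ) (p a b c : ℕ) :
    swapLetters (p + 1) (setThree w p a b c) = setThree w p a c b := by
  funext j
  rcases eq_or_ne j (p + 1) with rfl | h1
  · have h : p + 1 + 1 ≠ p := by omega
    simp [swapLetters_left, setThree, h]
  · rcases eq_or_ne j (p + 2) with rfl | h2
    · rw [swapLetters_right]; simp [setThree]
    · simp [swapLetters_of_ne _ h1 h2, setThree, h1, h2]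

theorem heckeGen_setThree (f : (ℕ → ℕ) → A) (w : ℕ → ℕ) (p a b c : ℕ) :
    heckeGen α β p f (setThree w p a b c)
      = exchangeRule α β a b (f (setThree w p a b c)) (f (setThree w p b a c)) := by
  rw [heckeGen_apply, swapLetters_setThree]; simp [setThree]

theorem heckeGen_succ_setThree (f : (ℕ → ℕ) → A) (w : ℕ → ℕ) (p a b c : ℕ) :
    heckeGen α β (p + 1) f (setThree w p a b c)
      = exchangeRule α β b c (f (setThree w p a b c)) (f (setThree w p a c b)) := by
  have h : p + 1 + 1 ≠ p := by omega
  rw [heckeGen_apply, swapLetters_succ_setThree]; simp [setThree, h]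

/-- Only three adjacent letters matter, and only through their relative order, so the relation is a
finite check. -/
theorem heckeGen_braid (p : ℕ) :
    heckeGen α β p * heckeGen α β (p + 1) * heckeGen α β p
      = heckeGen α β (p + 1) * heckeGen α β p * heckeGen α β (p + 1) := by
  ext f w
  rw [← setThree_self w p]
  generalize w p = a
  generalize w (p + 1) = b
  generalize w (p + 2) = c
  simp only [Module.End.mul_apply, heckeGen_setThree, heckeGen_succ_setThree]
  simp only [exchangeRule]
  rcases lt_trichotomy a b with h1 | h1 | h1 <;> rcases lt_trichotomy b c with h2 | h2 | h2 <;>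
    rcases lt_trichotomy a c with h3 | h3 | h3 <;> try omega
  all_goals
    first
    | subst h1; subst h2; simp only [lt_self_iff_false, if_true, if_false]
    | subst h1
      simp only [h2, h2.not_gt, h2.ne, h2.ne', lt_self_iff_false, if_true, if_false]
      try ring
    | subst h2
      simp only [h1, h1.not_gt, h1.ne, h1.ne', lt_self_iff_false, if_true, if_false]
      try ring
    | subst h3
      simp only [h1, h1.not_gt, h1.ne, h1.ne', h2, h2.not_gt, h2.ne, h2.ne', lt_self_iff_false,
        if_true, if_false]
      try ring
    | simp only [h1, h1.not_gt, h1.ne, h1.ne', h2, h2.not_gt, h2.ne, h2.ne', h3, h3.not_gt, h3.ne,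
        h3.ne', lt_self_iff_false, if_true, if_false]
      try ring

/-! ### Yang–Baxter equation and commutation of rows -/

/-- The solution of the Yang–Baxter equation attached to the Hecke generators. -/
def rMatrix (p : ℕ) (x y : A) : Module.End A ((ℕ → ℕ) → A) :=
  ((1 + α * x) * (1 + β * y)) • 1 + (y - x) • heckeGen α β p

theorem rMatrix_apply (p : ℕ) (x y : A) (f : (ℕ → ℕ) → A) (w : ℕ → ℕ) :
    rMatrix α β p x y f w
      = (1 + α * x) * (1 + β * y) * f w + (y - x) * heckeGen α β p f w := by
  simp [rMatrix]

theorem rMatrix_comm {p q : ℕ} (h : p + 2 ≤ q) (x y z t : A) :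
    Commute (rMatrix α β p x y) (rMatrix α β q z t) := by
  have h0 := heckeGen_comm α β h
  unfold rMatrix
  refine Commute.add_left ?_ ?_ <;> refine Commute.add_right ?_ ?_
  · exact ((Commute.one_left _).smul_left _)
  · exact ((Commute.one_left _).smul_left _)
  · exact ((Commute.one_right _).smul_right _)
  · exact (h0.smul_left _).smul_right _

/-- After expansion, the quadratic and braid relations bring both sides to the same combination of
products of the two generators. -/
theorem yangBaxter (p : ℕ) (x y z : A) :
    rMatrix α β p y z * rMatrix α β (p + 1) x z * rMatrix α β p x y
      = rMatrix α β (p + 1) x y * rMatrix α β p x z * rMatrix α β (p + 1) y z := by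
  have h1 := heckeGen_mul_self α β p
  have h2 := heckeGen_mul_self α β (p + 1)
  have h3 := heckeGen_braid α β p
  unfold rMatrix
  generalize heckeGen α β p = s at *
  generalize heckeGen α β (p + 1) = t at *
  simp only [add_mul, mul_add, smul_mul_assoc, mul_smul_comm, mul_one, one_mul, smul_add,
    h1, h2, h3]
  module

/-- The product of `k` consecutive `R`-matrices with the same parameter. -/
def row (x : A) (p : ℕ) : ℕ → Module.End A ((ℕ → ℕ) → A)
  | 0 => 1
  | k + 1 => row x p k * rMatrix α β (p + k) 0 x

theorem row_succ (x : A) (p k : ℕ) :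
    row α β x p (k + 1) = row α β x p k * rMatrix α β (p + k) 0 x := rfl

theorem row_succ' (x : A) (p k : ℕ) :
    row α β x p (k + 1) = rMatrix α β p 0 x * row α β x (p + 1) k := by
  induction k with
  | zero => simp [row]
  | succ k ih =>
    rw [row_succ, ih, row_succ α β x (p + 1) k, mul_assoc, show p + 1 + k = p + (k + 1) by ring]

theorem row_comm_right {p k q : ℕ} (h : p + k + 1 ≤ q) (x z t : A) :
    Commute (row α β x p k) (rMatrix α β q z t) := by
  induction k with
  | zero => exact Commute.one_left _
  | succ k ih =>
    exact Commute.mul_left (ih (by omega)) (rMatrix_comm α β (by omega) _ _ _ _)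

theorem row_comm_left {p k q : ℕ} (h : q + 2 ≤ p) (x z t : A) :
    Commute (rMatrix α β q z t) (row α β x p k) := by
  induction k with
  | zero => exact Commute.one_right _
  | succ k ih =>
    exact Commute.mul_right ih (rMatrix_comm α β (by omega) _ _ _ _)

/-- The train argument: the R-matrix passes one column at a time, each passage being a Yang–Baxter
move with third parameter 0. -/
theorem rMatrix_mul_row_mul_row (p k : ℕ) (x y : A) :
    rMatrix α β p x y * (row α β y (p + 1) k * row α β x p k)
      = row α β x (p + 1) k * row α β y p k * rMatrix α β (p + k) x y := by
  induction k with
  | zero => simp [row]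
  | succ k ih =>
    have hc (u v : A) : row α β u (p + 1) (k + 1) * row α β v p (k + 1)
        = row α β u (p + 1) k * row α β v p k
          * (rMatrix α β (p + k + 1) 0 u * rMatrix α β (p + k) 0 v) := by
      have := (row_comm_right α β (p := p) (k := k) (q := p + k + 1) le_rfl v 0 u).eq
      rw [row_succ, row_succ, show p + 1 + k = p + k + 1 by ring, mul_assoc,
        ← mul_assoc (rMatrix α β (p + k + 1) 0 u), ← this]
      simp only [mul_assoc]
    rw [hc, hc, ← mul_assoc, ih, mul_assoc _ (rMatrix α β (p + k) x y),
      ← mul_assoc (rMatrix α β (p + k) x y), yangBaxter]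
    simp only [mul_assoc, add_assoc]

/-- The product of the rows with parameters `x_{m-1}, …, x_0`, each crossing `k` columns. -/
def grid (k : ℕ) (x : ℕ → A) : ℕ → Module.End A ((ℕ → ℕ) → A)
  | 0 => 1
  | m + 1 => row α β (x m) m k * grid k x m

theorem grid_succ (k : ℕ) (x : ℕ → A) (m : ℕ) :
    grid α β k x (m + 1) = row α β (x m) m k * grid α β k x m := rfl

theorem grid_congr {k m : ℕ} {x y : ℕ → A} (h : ∀ j < m, x j = y j) :
    grid α β k x m = grid α β k y m := by
  induction m with
  | zero => rfl
  | succ m ih => rw [grid_succ, grid_succ, h m (by omega), ih fun j hj => h j (by omega)]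

theorem grid_comm {k m q : ℕ} (h : m + k ≤ q) (x : ℕ → A) (z t : A) :
    Commute (grid α β k x m) (rMatrix α β q z t) := by
  induction m with
  | zero => exact Commute.one_left _
  | succ m ih =>
    exact Commute.mul_left (row_comm_right α β (by omega) _ _ _) (ih (by omega))

/-- Two neighbouring rows of the grid are exchanged by an `R`-matrix. -/
theorem rMatrix_mul_grid {i m : ℕ} (h : i + 2 ≤ m) (k : ℕ) (x : ℕ → A) :
    rMatrix α β i (x i) (x (i + 1)) * grid α β k x m
      = grid α β k (x ∘ Equiv.swap i (i + 1)) m * rMatrix α β (i + k) (x i) (x (i + 1)) := by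
  induction m, h using Nat.le_induction with
  | base =>
    have h0 : grid α β k (x ∘ Equiv.swap i (i + 1)) i = grid α β k x i :=
      grid_congr α β fun j hj => by
        rw [Function.comp_apply, Equiv.swap_apply_of_ne_of_ne (by omega) (by omega)]
    -- The rows below i act on positions too far left to meet the R-matrix once it has reached
    -- position i + k.
    rw [grid_succ, grid_succ, grid_succ, grid_succ, h0]
    simp only [Function.comp_apply, Equiv.swap_apply_left, Equiv.swap_apply_right]
    have h1 := congrArg (· * grid α β k x i) (rMatrix_mul_row_mul_row α β i k (x i) (x (i + 1)))
    have h2 := (grid_comm α β (q := i + k) le_rfl x (x i) (x (i + 1))).eq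
    simp only [mul_assoc, ← h2] at h1 ⊢
    simpa only [mul_assoc, h2] using h1
  | succ m hm ih =>
    rw [grid_succ, grid_succ, ← mul_assoc, (row_comm_left α β hm _ _ _).eq, mul_assoc, ih,
      Function.comp_apply, Equiv.swap_apply_of_ne_of_ne (by omega) (by omega), mul_assoc]

/-- The indicator function of the word `u`. -/
noncomputable def indicator (A : Type*) [CommRing A] (u : ℕ → ℕ) : (ℕ → ℕ) → A :=
  open Classical in Pi.single u 1

/-- On equal letters the generator has eigenvalue -β. The scalar equals 1 + (α + β)x + αβxy, the
coefficient of ∂_i in T_i. -/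
theorem rMatrix_indicator {u : ℕ → ℕ} {p : ℕ} (h : u p = u (p + 1)) (x y : A) :
    rMatrix α β p x y (indicator A u)
      = ((1 + α * x) * (1 + β * y) - β * (y - x)) • indicator A u := by
  classical
  funext w
  rw [rMatrix_apply, heckeGen_apply, Pi.smul_apply, smul_eq_mul]
  rcases eq_or_ne w u with rfl | hw
  · simp only [exchangeRule, h, lt_self_iff_false, if_true, if_false]; ring
  · have hw' : swapLetters p w ≠ u := fun e => hw <| by
      rw [← swapLetters_swapLetters p w, e, swapLetters_eq_self h]
    simp [exchangeRule, indicator, Pi.single_eq_of_ne hw, Pi.single_eq_of_ne hw']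

/-! ### Change of coefficients -/

variable {α β}

theorem comp_heckeGen {φ : A →+* A} (hα : φ α = α) (hβ : φ β = β) (p : ℕ) (f : (ℕ → ℕ) → A) :
    φ ∘ heckeGen α β p f = heckeGen α β p (φ ∘ f) := by
  funext w
  simp only [Function.comp_apply, heckeGen_apply, exchangeRule]
  split_ifs <;> simp [hα, hβ]

theorem comp_rMatrix {φ : A →+* A} (hα : φ α = α) (hβ : φ β = β) (p : ℕ) (x y : A)
    (f : (ℕ → ℕ) → A) :
    φ ∘ rMatrix α β p x y f = rMatrix α β p (φ x) (φ y) (φ ∘ f) := by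
  funext w
  rw [rMatrix_apply, ← comp_heckeGen hα hβ]
  simp [rMatrix_apply, hα, hβ]

theorem comp_row {φ : A →+* A} (hα : φ α = α) (hβ : φ β = β) (x : A) (p k : ℕ)
    (f : (ℕ → ℕ) → A) :
    φ ∘ row α β x p k f = row α β (φ x) p k (φ ∘ f) := by
  induction k generalizing f with
  | zero => rfl
  | succ k ih =>
    rw [row_succ, row_succ, Module.End.mul_apply, Module.End.mul_apply, ih, comp_rMatrix hα hβ,
      map_zero]

/-- Used with φ = s_i: exchanging variables in a value of the partition function amounts to
exchanging row parameters. -/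
theorem comp_grid {φ : A →+* A} (hα : φ α = α) (hβ : φ β = β) (k : ℕ) (x : ℕ → A) (m : ℕ)
    (f : (ℕ → ℕ) → A) :
    φ ∘ grid α β k x m f = grid α β k (φ ∘ x) m (φ ∘ f) := by
  induction m with
  | zero => rfl
  | succ m ih =>
    rw [grid_succ, grid_succ, Module.End.mul_apply, Module.End.mul_apply, comp_row hα hβ, ih]
    rfl

theorem comp_indicator (φ : A →+* A) (u : ℕ → ℕ) : φ ∘ indicator A u = indicator A u := by
  classical
  funext w
  rcases eq_or_ne w u with rfl | h
  · simp [indicator]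
  · simp [indicator, Pi.single_eq_of_ne h]

/-! ### Supports -/

variable (α β)

theorem rMatrix_eq_zero {p : ℕ} {f : (ℕ → ℕ) → A} {w : ℕ → ℕ} (x y : A)
    (hw : f w = 0) (hs : f (swapLetters p w) = 0) : rMatrix α β p x y f w = 0 := by
  rw [rMatrix_apply, heckeGen_apply, hw, hs]
  simp [exchangeRule]

theorem row_eq_zero {Q : (ℕ → ℕ) → Prop} {p k : ℕ} {f : (ℕ → ℕ) → A}
    (hQ : ∀ q, p ≤ q → q < p + k → ∀ w, Q w → Q (swapLetters q w))
    (hf : ∀ w, Q w → f w = 0) (x : A) {w : ℕ → ℕ} (hw : Q w) : row α β x p k f w = 0 := by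
  induction k generalizing f with
  | zero => exact hf w hw
  | succ k ih =>
    rw [row_succ, Module.End.mul_apply]
    exact ih (fun q h1 h2 => hQ q h1 (by omega)) fun w hw =>
      rMatrix_eq_zero α β _ _ (hf w hw) (hf _ (hQ _ (by omega) (by omega) w hw))

theorem row_add (x : A) (p k l : ℕ) :
    row α β x p (k + l) = row α β x p k * row α β x (p + k) l := by
  induction l with
  | zero => simp [row]
  | succ l ih => rw [← add_assoc, row_succ, ih, row_succ, mul_assoc, add_assoc]

theorem row_apply_of_const {p k : ℕ} {w : ℕ → ℕ} (h : ∀ q, p ≤ q → q < p + k → w q = w (q + 1))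
    (x : A) (f : (ℕ → ℕ) → A) : row α β x p k f w = f w := by
  induction k generalizing f with
  | zero => rfl
  | succ k ih =>
    rw [row_succ, Module.End.mul_apply, ih fun q h1 h2 => h q h1 (by omega), rMatrix_apply,
      heckeGen_apply, exchangeRule, h (p + k) (by omega) (by omega)]
    simp only [lt_self_iff_false, if_true, if_false]
    ring

theorem swapLetters_avoids {q m a : ℕ} (hq : q ≠ m) {w : ℕ → ℕ} (h : ∀ j ≤ m, w j ≠ a) :
    ∀ j ≤ m, swapLetters q w j ≠ a := by
  intro j hj
  rcases eq_or_ne j q with rfl | h1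
  · rw [swapLetters_left]; exact h _ (by omega)
  · rcases eq_or_ne j (q + 1) with rfl | h2
    · rw [swapLetters_right]; exact h _ (by omega)
    · rw [swapLetters_of_ne _ h1 h2]; exact h _ hj

/-! ### The frozen boundary: evaluation at the identity -/

/-- The word `0, …, p - 1, n - 1, n - 2, …, p, n, n, …`. -/
def cornerWord (n p : ℕ) : ℕ → ℕ := fun j =>
  if j < p then j else if j < n then n - 1 - (j - p) else n

/-- The letter n-1-c starts in position c, and each row moves it at most one place to the right. -/
theorem grid_indicator_eq_zero {n p c : ℕ} (hc : c < n) (x : ℕ → A) {w : ℕ → ℕ}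
    (hw : ∀ j ≤ p + c, w j ≠ n - 1 - c) :
    grid α β n x p (indicator A (cornerWord n 0)) w = 0 := by
  classical
  induction p generalizing w with
  | zero =>
    have : w ≠ cornerWord n 0 := by
      rintro rfl
      exact hw c (by omega) (by simp [cornerWord, hc])
    exact Pi.single_eq_of_ne this _
  | succ p ih =>
    -- The row is split at its only R-matrix that exchanges positions p + c and p + c + 1; the
    -- others preserve avoidance of the letter.
    obtain ⟨l, rfl⟩ : ∃ l, n = c + (l + 1) := ⟨n - c - 1, by omega⟩
    rw [grid_succ, Module.End.mul_apply, row_add, row_succ', Module.End.mul_apply,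
      Module.End.mul_apply]
    refine row_eq_zero α β (Q := fun w => ∀ j ≤ p + 1 + c, w j ≠ c + (l + 1) - 1 - c)
      (fun q _ _ w hw => swapLetters_avoids (by omega) hw) (fun w hw => ?_) _ hw
    have h1 : ∀ w : ℕ → ℕ, (∀ j ≤ p + c, w j ≠ c + (l + 1) - 1 - c) →
        row α β (x p) (p + c + 1) l
          (grid α β (c + (l + 1)) x p (indicator A (cornerWord (c + (l + 1)) 0))) w = 0 :=
      fun w hw => row_eq_zero α β (Q := fun w => ∀ j ≤ p + c, w j ≠ c + (l + 1) - 1 - c)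
        (fun q _ _ w hw => swapLetters_avoids (by omega) hw) (fun w hw => ih hw) _ hw
    have h2 := swapLetters_avoids (q := p + c) (by omega) hw
    exact rMatrix_eq_zero α β _ _ (h1 w fun j hj => hw j (by omega))
      (h1 _ fun j hj => h2 j (by omega))

/-- The word `0, …, p - 1, n - 1, …, n - c, p, n - c - 1, …, p + 1, n, n, …`. -/
def hookWord (n p c : ℕ) : ℕ → ℕ := fun j =>
  if j < p then j else if j < p + c then n - 1 - (j - p) else if j = p + c then p
    else if j < n then n + p - j else n

/-- Only one configuration of the row survives: the letter p exchanges with d larger letters, each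
with weight y, and then meets n with weight 1 + βy. -/
theorem row_hookWord {n p c d : ℕ} (h : p + c + d + 1 = n) (x : ℕ → A) (y : A) :
    row α β y (p + c) (n - c) (grid α β n x p (indicator A (cornerWord n 0))) (hookWord n p c)
      = (1 + β * y) * y ^ d
        * grid α β n x p (indicator A (cornerWord n 0)) (cornerWord n p) := by
  set f := grid α β n x p (indicator A (cornerWord n 0)) with hf
  have hz : ∀ l, ∀ w : ℕ → ℕ, (∀ j ≤ p + c, w j ≠ n - 1 - c) →
      row α β y (p + c + 1) l f w = 0 := fun l w hw =>
    row_eq_zero α β (Q := fun w => ∀ j ≤ p + c, w j ≠ n - 1 - c)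
      (fun q _ _ w hw => swapLetters_avoids (by omega) hw)
      (fun w hw => grid_indicator_eq_zero α β (by omega) x hw) _ hw
  induction d generalizing c with
  | zero =>
    have h1 : hookWord n p c (p + c) = p := by simp [hookWord]
    have h2 : hookWord n p c (p + c + 1) = n := by
      simp only [hookWord]; split_ifs <;> omega
    have h3 : hookWord n p c = cornerWord n p := by
      funext j; simp only [hookWord, cornerWord]; split_ifs <;> omega
    -- The exchanged term vanishes because it pushes p too far right; what remains of the row sees
    -- only letters n and acts trivially.
    rw [show n - c = p + 1 by omega, row_succ', Module.End.mul_apply, rMatrix_apply,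
      heckeGen_apply, exchangeRule, h1, h2, if_pos (by omega), hz _ (swapLetters _ _),
      row_apply_of_const, h3]
    · ring
    · intro q h4 h5; simp only [hookWord]; split_ifs <;> omega
    · intro j hj
      rcases eq_or_ne j (p + c) with rfl | h4
      · rw [swapLetters_left, h2]; omega
      · rw [swapLetters_of_ne _ h4 (by omega)]; simp only [hookWord]; split_ifs <;> omega
  | succ d ih =>
    have h1 : hookWord n p c (p + c) = p := by simp [hookWord]
    have h2 : hookWord n p c (p + c + 1) = n - 1 - c := by
      simp only [hookWord]; split_ifs <;> omega
    have h3 : swapLetters (p + c) (hookWord n p c) = hookWord n p (c + 1) := by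
      funext j
      rcases eq_or_ne j (p + c) with rfl | h4
      · rw [swapLetters_left]; simp only [hookWord]; split_ifs <;> omega
      · rcases eq_or_ne j (p + c + 1) with rfl | h5
        · rw [swapLetters_right]; simp only [hookWord]; split_ifs <;> omega
        · rw [swapLetters_of_ne _ h4 h5]; simp only [hookWord]; split_ifs <;> omega
    have h4 := @ih (c + 1) (by omega) fun l w hw =>
      row_eq_zero α β (Q := fun w => ∀ j ≤ p + (c + 1), w j ≠ n - 1 - (c + 1))
      (fun q _ _ w hw => swapLetters_avoids (by omega) hw)
      (fun w hw => grid_indicator_eq_zero α β (by omega) x hw) _ hw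
    -- Here the unexchanged term vanishes, since it leaves n-1-c too far right; the exchanged one
    -- contributes y.
    rw [show n - c = n - (c + 1) + 1 by omega, row_succ', Module.End.mul_apply, rMatrix_apply,
      heckeGen_apply, exchangeRule, h1, h2, if_pos (by omega), hz, h3,
      show p + c + 1 = p + (c + 1) by ring, h4]
    · ring
    · intro j hj; simp only [hookWord]; split_ifs <;> omega

theorem grid_cornerWord {n p : ℕ} (h : p ≤ n) (x : ℕ → A) :
    grid α β n x p (indicator A (cornerWord n 0)) (cornerWord n p)
      = ∏ j ∈ Finset.range p, ((1 + β * x j) * x j ^ (n - 1 - j)) := by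
  induction p with
  | zero => classical simp [grid, indicator]
  | succ p ih =>
    have h1 : cornerWord n (p + 1) = hookWord n p 0 := by
      funext j; simp only [hookWord, cornerWord]; split_ifs <;> omega
    have h2 := row_hookWord α β (n := n) (p := p) (c := 0) (d := n - 1 - p) (by omega) x (x p)
    rw [grid_succ, Module.End.mul_apply, h1, Finset.prod_range_succ, ← ih (by omega)]
    simp only [add_zero, Nat.sub_zero] at h2
    rw [h2, mul_comm]

/-! ### Positivity -/

variable {α β}

/-- The extra factor 1 + βy passes from "the right letter is below n" to "the left letter is below
n". It is inherited, except in the unexchanged term at an ascent, whose weight supplies it. -/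
theorem rMatrix_mul_mem {S : Subsemiring A} (hα : α ∈ S) (hβ : β ∈ S) {y : A} (hy : y ∈ S)
    {n p q : ℕ} (hq : p ≤ q) {c : A} {f : (ℕ → ℕ) → A}
    (hf : ∀ w, (∀ j < p, w j < n) → (∃ g ∈ S, f w = c * g) ∧
      (w (q + 1) < n → ∃ g ∈ S, f w = c * (1 + β * y) * g))
    {w : ℕ → ℕ} (hw : ∀ j < p, w j < n) :
    (∃ g ∈ S, rMatrix α β q 0 y f w = c * g) ∧
      (w q < n → ∃ g ∈ S, rMatrix α β q 0 y f w = c * (1 + β * y) * g) := by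
  have hs : ∀ j < p, swapLetters q w j < n := fun j hj => by
    rw [swapLetters_of_ne _ (by omega) (by omega)]; exact hw j hj
  obtain ⟨⟨g, hg, e⟩, h1⟩ := hf w hw
  obtain ⟨⟨g', hg', e'⟩, h2⟩ := hf _ hs
  rw [swapLetters_right] at h2
  have one (t : A) (ht : t ∈ S) : 1 + t * y ∈ S := add_mem (one_mem S) (mul_mem ht hy)
  simp only [rMatrix_apply, heckeGen_apply, exchangeRule]
  rcases lt_trichotomy (w q) (w (q + 1)) with h | h | h
  · simp only [h, if_true]
    refine ⟨⟨(1 + β * y) * g + y * g', add_mem (mul_mem (one β hβ) hg) (mul_mem hy hg'), ?_⟩,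
      fun hn => ?_⟩
    · rw [e, e']; ring
    · obtain ⟨k, hk, e2⟩ := h2 hn
      exact ⟨g + y * k, add_mem hg (mul_mem hy hk), by rw [e, e2]; ring⟩
  · simp only [h, lt_self_iff_false, if_true, if_false]
    refine ⟨⟨g, hg, ?_⟩, fun hn => ?_⟩
    · rw [e]; ring
    · obtain ⟨k, hk, e2⟩ := h1 hn
      exact ⟨k, hk, by rw [e2]; ring⟩
  · simp only [h.not_gt, h.ne', if_false]
    have hz : α * β * y ∈ S := mul_mem (mul_mem hα hβ) hy
    refine ⟨⟨(1 + α * y) * g + α * β * y * g',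
      add_mem (mul_mem (one α hα) hg) (mul_mem hz hg'), ?_⟩, fun hn => ?_⟩
    · rw [e, e']; ring
    · obtain ⟨k, hk, e1⟩ := h1 (h.trans hn)
      obtain ⟨k', hk', e2⟩ := h2 hn
      exact ⟨(1 + α * y) * k + α * β * y * k',
        add_mem (mul_mem (one α hα) hk) (mul_mem hz hk'), by rw [e1, e2]; ring⟩

theorem row_mul_mem {S : Subsemiring A} (hα : α ∈ S) (hβ : β ∈ S) {y : A} (hy : y ∈ S)
    {n p k : ℕ} {c : A} {f : (ℕ → ℕ) → A}
    (hf : ∀ w, (∀ j < p, w j < n) → (∃ g ∈ S, f w = c * g) ∧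
      (w (p + k) < n → ∃ g ∈ S, f w = c * (1 + β * y) * g))
    {w : ℕ → ℕ} (hw : ∀ j < p, w j < n) :
    (∃ g ∈ S, row α β y p k f w = c * g) ∧
      (w p < n → ∃ g ∈ S, row α β y p k f w = c * (1 + β * y) * g) := by
  induction k generalizing f with
  | zero => exact hf w hw
  | succ k ih =>
    rw [row_succ, Module.End.mul_apply]
    exact ih fun w hw => rMatrix_mul_mem hα hβ hy (Nat.le_add_right p k) hf hw

theorem grid_eq_zero_of_lt {n p q : ℕ} (hq : p + n ≤ q) (x : ℕ → A) {w : ℕ → ℕ} (hw : w q < n) :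
    grid α β n x p (indicator A (cornerWord n 0)) w = 0 := by
  classical
  induction p generalizing w with
  | zero =>
    have : w ≠ cornerWord n 0 := by
      rintro rfl
      simp only [cornerWord] at hw
      split_ifs at hw <;> omega
    exact Pi.single_eq_of_ne this _
  | succ p ih =>
    rw [grid_succ, Module.End.mul_apply]
    refine row_eq_zero α β (Q := fun w => w q < n) (fun r h1 h2 w hw => ?_)
      (fun w hw => ih (by omega) hw) _ hw
    rwa [swapLetters_of_ne _ (by omega) (by omega)]

theorem grid_mul_mem {S : Subsemiring A} (hα : α ∈ S) (hβ : β ∈ S) {x : ℕ → A}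
    (hx : ∀ j, x j ∈ S) {n p : ℕ} {w : ℕ → ℕ} (hw : ∀ j < p, w j < n) :
    ∃ g ∈ S, grid α β n x p (indicator A (cornerWord n 0)) w
      = (∏ j ∈ Finset.range p, (1 + β * x j)) * g := by
  classical
  induction p generalizing w with
  | zero =>
    refine ⟨indicator A (cornerWord n 0) w, ?_, by simp [grid]⟩
    rcases eq_or_ne w (cornerWord n 0) with rfl | h
    · simp [indicator]
    · simp [indicator, Pi.single_eq_of_ne h]
  | succ p ih =>
    rw [grid_succ, Module.End.mul_apply, Finset.prod_range_succ]
    refine (row_mul_mem hα hβ (hx p) (n := n) (fun w hw => ⟨ih hw, fun hn => ?_⟩)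
      fun j hj => hw j (by omega)).2 (hw p (by omega))
    -- At the right end of a new row a letter below n is impossible, so the extra divisibility
    -- starts from the value 0.
    exact ⟨0, zero_mem S, by rw [grid_eq_zero_of_lt le_rfl x hn, mul_zero]⟩

end Hecke

open MvPolynomial

/-! ### Reduced words -/

section Words

variable {n : ℕ}

/-- The exchange condition: a product of simple transpositions that inverts `a < b` becomes
shorter after left multiplication by the transposition `(a b)`. -/
theorem exists_shorter_word {a b : Fin n} (hab : a < b) (l : List (Fin (n - 1)))
    (h : (l.map simple).prod⁻¹ b < (l.map simple).prod⁻¹ a) :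
    ∃ l' : List (Fin (n - 1)), (l'.map simple).prod = Equiv.swap a b * (l.map simple).prod ∧
      l'.length < l.length := by
  induction l generalizing a b with
  | nil => exact absurd h (by simpa using hab.le)
  | cons i l ih =>
    simp only [List.map_cons, List.prod_cons, mul_inv_rev, Equiv.Perm.mul_apply] at h ⊢
    have hinv : (simple i)⁻¹ = simple i := by simp [simple]
    rw [hinv] at h
    rcases lt_or_ge (simple i a) (simple i b) with hlt | hge
    · obtain ⟨l', h1, h2⟩ := ih hlt h
      refine ⟨i :: l', ?_, by simpa using h2⟩
      rw [List.map_cons, List.prod_cons, h1, Equiv.swap_apply_apply, hinv]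
      simp [← mul_assoc, simple]
    · have h1 : a = lo i ∧ b = hi i := by
        simp only [simple, Equiv.swap_apply_def, Fin.le_def, Fin.lt_def, Fin.ext_iff,
          apply_ite Fin.val, lo, hi] at hge hab ⊢
        split_ifs at hge <;> omega
      refine ⟨l, ?_, by simp⟩
      rw [h1.1, h1.2, ← mul_assoc]
      simp [simple]

theorem IsReducedWord.tail {w : Equiv.Perm (Fin n)} {i : Fin (n - 1)} {l : List (Fin (n - 1))}
    (h : IsReducedWord w (i :: l)) : IsReducedWord (l.map simple).prod l := by
  refine ⟨rfl, fun l' hl' => ?_⟩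
  have := h.2 (i :: l') (by rw [← h.1, List.map_cons, List.prod_cons, hl']; rfl)
  simpa using this

/-- Otherwise the exchange condition would shorten the word. This ascent selects the branch in which
the generator just exchanges letters. -/
theorem IsReducedWord.inv_lo_lt_inv_hi {w : Equiv.Perm (Fin n)} {i : Fin (n - 1)}
    {l : List (Fin (n - 1))} (h : IsReducedWord w (i :: l)) :
    (l.map simple).prod⁻¹ (lo i) < (l.map simple).prod⁻¹ (hi i) := by
  by_contra! hc
  have hlt : lo i < hi i := by simp [lo, hi, Fin.lt_def]
  have hne : (l.map simple).prod⁻¹ (hi i) ≠ (l.map simple).prod⁻¹ (lo i) := fun e =>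
    hlt.ne' ((l.map simple).prod⁻¹.injective e)
  obtain ⟨l', h1, h2⟩ := exists_shorter_word hlt l (lt_of_le_of_ne hc hne)
  have := h.2 l' (by rw [h1, ← h.1, List.map_cons, List.prod_cons]; rfl)
  simp at this
  omega

/-- The one-line notation of a permutation of `n` letters as a word, continued by `n, n, …`. -/
def permWord (w : Equiv.Perm (Fin n)) : ℕ → ℕ := fun j => if h : j < n then w ⟨j, h⟩ else n

theorem permWord_lt (w : Equiv.Perm (Fin n)) {j : ℕ} (h : j < n) : permWord w j < n := by
  simp [permWord, h]

theorem permWord_one : permWord (1 : Equiv.Perm (Fin n)) = cornerWord n n := by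
  funext j
  by_cases h : j < n <;> simp [permWord, cornerWord, h]

theorem permWord_lo (w : Equiv.Perm (Fin n)) (i : Fin (n - 1)) : permWord w i = w (lo i) := by
  have h : i.1 < n := (lo i).2
  simp [permWord, h, lo]

theorem permWord_hi (w : Equiv.Perm (Fin n)) (i : Fin (n - 1)) :
    permWord w (i + 1) = w (hi i) := by
  have h : i.1 + 1 < n := (hi i).2
  simp [permWord, h, hi]

theorem swapLetters_permWord (w : Equiv.Perm (Fin n)) (i : Fin (n - 1)) :
    swapLetters i (permWord w) = permWord (w * simple i) := by
  funext j
  rcases eq_or_ne j i with rfl | h1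
  · rw [swapLetters_left, permWord_lo, permWord_hi]; simp [simple]
  · rcases eq_or_ne j (i + 1) with rfl | h2
    · rw [swapLetters_right, permWord_lo, permWord_hi]; simp [simple]
    · rw [swapLetters_of_ne _ h1 h2]
      simp only [permWord]
      split_ifs with h
      · rw [Equiv.Perm.mul_apply, simple, Equiv.swap_apply_of_ne_of_ne] <;>
          simpa [lo, hi, Fin.ext_iff]
      · rfl

end Words

/-! ### The operators `T_i` on the partition function -/

section Partition

variable {n : ℕ} {R : Type*} [CommRing R]

/-- The variables `x_0, …, x_{n-1}`, continued by zeros. -/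
noncomputable def rowVar (n : ℕ) (R : Type*) [CommRing R] (j : ℕ) : MvPolynomial (Fin n) R :=
  if h : j < n then X ⟨j, h⟩ else 0

theorem vars_lo (i : Fin (n - 1)) : rowVar n R i = X (lo i) := by
  have h : i.1 < n := (lo i).2
  simp [rowVar, h, lo]

theorem vars_hi (i : Fin (n - 1)) : rowVar n R (i + 1) = X (hi i) := by
  have h : i.1 + 1 < n := (hi i).2
  simp [rowVar, h, hi]

theorem rename_simple_comp_rowVar (i : Fin (n - 1)) :
    (rename (simple i) : MvPolynomial (Fin n) R →ₐ[R] _) ∘ rowVar n R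
      = rowVar n R ∘ Equiv.swap (i : ℕ) (i + 1) := by
  funext j
  simp only [Function.comp_apply]
  rcases eq_or_ne j i with rfl | h1
  · rw [Equiv.swap_apply_left, vars_lo, vars_hi]; simp [simple]
  · rcases eq_or_ne j (i + 1) with rfl | h2
    · rw [Equiv.swap_apply_right, vars_lo, vars_hi]; simp [simple]
    · rw [Equiv.swap_apply_of_ne_of_ne h1 h2]
      simp only [rowVar]
      split_ifs with h
      · rw [rename_X, simple, Equiv.swap_apply_of_ne_of_ne] <;> simpa [lo, hi, Fin.ext_iff]
      · simp

/-- The partition function of the `n × n` lattice model as a function of the boundary word. -/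
noncomputable def partitionFunction (n : ℕ) (α β : R) : (ℕ → ℕ) → MvPolynomial (Fin n) R :=
  grid (C α) (C β) n (rowVar n R) n (indicator _ (cornerWord n 0))

theorem rMatrix_partitionFunction (α β : R) (i : Fin (n - 1)) (w : ℕ → ℕ) :
    rMatrix (C α) (C β) i (X (lo i)) (X (hi i)) (partitionFunction n α β) w
      = ((1 + C α * X (lo i)) * (1 + C β * X (hi i)) - C β * (X (hi i) - X (lo i)))
        * swapVars i (partitionFunction n α β w) := by
  have hi := i.2
  have h1 := congrArg (fun f => f (indicator _ (cornerWord n 0)) w)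
    (rMatrix_mul_grid (C α : MvPolynomial (Fin n) R) (C β) (i := i) (m := n) (by omega) n
      (rowVar n R))
  simp only [Module.End.mul_apply, vars_lo, vars_hi] at h1
  -- The letters in positions i + n and i + n + 1 are both n.
  rw [rMatrix_indicator _ _ (by simp only [cornerWord]; split_ifs <;> omega), map_smul,
    Pi.smul_apply, smul_eq_mul] at h1
  have h2 := comp_grid (α := C α) (β := C β)
    (φ := ((rename (simple i) : MvPolynomial (Fin n) R →ₐ[R] _) : _ →+* _)) (by simp) (by simp) n
    (rowVar n R) n (indicator _ (cornerWord n 0))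
  rw [comp_indicator] at h2
  have h3 := congrFun h2 w
  have h4 := rename_simple_comp_rowVar (R := R) i
  rw [partitionFunction, h1, ← h4]
  congr 1
  exact h3.symm

theorem heckeGen_partitionFunction [IsDomain R] (α β : R) (i : Fin (n - 1)) (w : ℕ → ℕ) :
    heckeGen (C α) (C β) i (partitionFunction n α β) w
      = T β α 0 i (partitionFunction n α β w) := by
  have h0 : (X (hi i) - X (lo i) : MvPolynomial (Fin n) R) ≠ 0 :=
    sub_ne_zero.mpr fun e => lo_ne_hi i (X_injective e).symm
  have h1 := rMatrix_partitionFunction α β i w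
  have h2 := mul_dividedDiff i (partitionFunction n α β w)
  rw [rMatrix_apply] at h1
  refine mul_left_cancel₀ h0 ?_
  simp only [T, map_zero, map_add, map_mul, add_zero, zero_mul]
  linear_combination h1 - (C α * X (lo i) + C β * X (lo i) + 1
    + C β * C α * X (lo i) * X (hi i)) * h2

theorem partitionFunction_simple [IsDomain R] (α β : R) {w : Equiv.Perm (Fin n)} {i : Fin (n - 1)}
    (h : w (lo i) < w (hi i)) :
    partitionFunction n α β (permWord (w * simple i))
      = T β α 0 i (partitionFunction n α β (permWord w)) := by
  rw [← heckeGen_partitionFunction, heckeGen_apply, exchangeRule, if_pos, swapLetters_permWord]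
  rw [permWord_lo, permWord_hi]
  exact h

theorem dividedDiff_mul [IsDomain R] {i : Fin (n - 1)} {c : MvPolynomial (Fin n) R}
    (hc : swapVars i c = c) (f : MvPolynomial (Fin n) R) :
    dividedDiff i (c * f) = c * dividedDiff i f := by
  refine (eq_dividedDiff i _ _ ?_).symm
  have : swapVars i (c * f) = c * swapVars i f := by
    conv_rhs => rw [← hc]
    exact map_mul _ _ _
  rw [this]
  linear_combination c * mul_dividedDiff i f

theorem wordT_mul [IsDomain R] (α β γ : R) {c : MvPolynomial (Fin n) R}
    (hc : ∀ i : Fin (n - 1), swapVars i c = c) (l : List (Fin (n - 1)))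
    (f : MvPolynomial (Fin n) R) : wordT β α γ l (c * f) = c * wordT β α γ l f := by
  induction l with
  | nil => rfl
  | cons i l ih =>
    simp only [wordT, List.foldr_cons] at ih ⊢
    rw [ih, T, T, dividedDiff_mul (hc i)]
    ring

/-- The symmetric polynomial `∏ (1 + β x_j)`. -/
noncomputable def turnFactor (n : ℕ) (β : R) : MvPolynomial (Fin n) R := ∏ j, (1 + C β * X j)

theorem swapVars_turnFactor (β : R) (i : Fin (n - 1)) :
    swapVars i (turnFactor n β) = turnFactor n β := by
  simp only [swapVars, turnFactor, map_prod, map_add, map_one, map_mul, rename_C, rename_X]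
  exact Equiv.prod_comp (simple i) fun j => 1 + C β * X j

theorem turnFactor_ne_zero [Nontrivial R] (β : R) : turnFactor n β ≠ 0 := by
  intro h
  have := congrArg constantCoeff h
  simp [turnFactor, map_prod] at this

theorem prod_range_rowVar (β : R) :
    ∏ j ∈ Finset.range n, (1 + C β * rowVar n R j) = turnFactor n β := by
  rw [Finset.prod_range, turnFactor]
  simp [rowVar]

theorem partitionFunction_one (α β : R) :
    partitionFunction n α β (permWord (1 : Equiv.Perm (Fin n)))
      = turnFactor n β * seed R (0 : Fin n → ℕ) := by
  rw [permWord_one, partitionFunction, grid_cornerWord _ _ le_rfl, Finset.prod_mul_distrib,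
    prod_range_rowVar, seed, Finset.prod_range]
  simp [rowVar]

/-- The inverse appears because T_i is applied on the left of the word, whereas exchanging positions
multiplies a permutation on the right. -/
theorem partitionFunction_eq_wordT [IsDomain R] (α β : R) {w : Equiv.Perm (Fin n)}
    {l : List (Fin (n - 1))} (h : IsReducedWord w l) :
    partitionFunction n α β (permWord w⁻¹) = turnFactor n β * wordT β α 0 l (seed R 0) := by
  induction l generalizing w with
  | nil =>
    obtain rfl : 1 = w := h.1
    rw [inv_one, partitionFunction_one]; rfl
  | cons i l ih =>
    have hinv : (simple i)⁻¹ = simple i := by simp [simple]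
    have h1 := partitionFunction_simple α β h.inv_lo_lt_inv_hi
    rw [← h.1, List.map_cons, List.prod_cons, mul_inv_rev, hinv, h1, ih h.tail,
      ← wordT_mul α β 0 (swapVars_turnFactor β), ← wordT_mul α β 0 (swapVars_turnFactor β)]
    rfl

end Partition

end Kirillov

open Kirillov MvPolynomial in
theorem theorem1p3 (n : ℕ) (hn : 0 < n) (w : Equiv.Perm (Fin n)) :
    (∀ l : List (Fin (n - 1)), Kirillov.IsReducedWord w l →
      Kirillov.wordT Kirillov.beta Kirillov.alpha 0 l (Kirillov.seed Kirillov.Coeff 0) =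
        Kirillov.heckeGrothendieck w) ∧
    Kirillov.heckeGrothendieck w ∈ Kirillov.natPolynomials n := by
  have h0 := partitionFunction_eq_wordT alpha beta (exists_isReducedWord w).choose_spec
  refine ⟨fun l hl => mul_left_cancel₀ (turnFactor_ne_zero beta) ?_, ?_⟩
  · exact (partitionFunction_eq_wordT alpha beta hl).symm.trans h0
  · let φ : MvPolynomial (Fin n) (MvPolynomial (Fin 2) ℕ) →+* MvPolynomial (Fin n) Coeff :=
      MvPolynomial.map (MvPolynomial.map (Nat.castRingHom ℤ))
    have hα : C alpha ∈ φ.rangeS := ⟨C (X 1), by simp [φ, alpha]⟩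
    have hβ : C beta ∈ φ.rangeS := ⟨C (X 0), by simp [φ, beta]⟩
    have hx : ∀ j, rowVar n Coeff j ∈ φ.rangeS := fun j => by
      unfold rowVar
      split_ifs with h
      · exact ⟨X ⟨j, h⟩, by simp [φ]⟩
      · exact zero_mem _
    obtain ⟨g, hg, e⟩ := grid_mul_mem hα hβ hx (w := permWord w⁻¹) (p := n)
      fun j hj => permWord_lt _ hj
    rw [prod_range_rowVar] at e
    have : heckeGrothendieck w = g := mul_left_cancel₀ (turnFactor_ne_zero beta) (h0.symm.trans e)
    rw [this]
    exact hg
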